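/- Let $\sigma>0$, $\lambda>0$, $D_e>0$. For every $n\ge 1$ let $\mathbf u=\mathbf u^{(n)}\in\{-1,+1\}^n$ be a watermark and let the covertext $\mathbf X=(X_1,\dots,X_n)$ have i.i.d. components $X_i\sim\mathcal N(0,\sigma^2)$. For $\mathbf y\in\mathbb R^n$ put $\hat\rho_{\mathbf u\mathbf y}=\frac{\langle \mathbf u,\mathbf y\rangle}{\|\mathbf u\|\,\|\mathbf y\|}$, and let $T=\sqrt{1-e^{-2\lambda}}$. The additive embedder produces $\mathbf Y=\mathbf X+\sqrt{D_e}\,\mathbf u$, and its false-negative probability is $P^{ae}_{n}=\Pr\{\hat\rho_{\mathbf u\mathbf Y}\le T\}$. The sign embedder produces $\mathbf Y=\mathbf X+\mathrm{sgn}(\rho)\sqrt{D_e}\,\mathbf u$, where $\rho=\frac1n\langle\mathbf X,\mathbf u\rangle$ and $\mathrm{sgn}(t)=1$ for $t\ge0$, $\mathrm{sgn}(t)=-1$ for $t<0$, and its false-negative probability is $P^{se}_{n}=\Pr\{\hat\rho_{\mathbf u\mathbf Y}^2\le 1-e^{-2\lambda}\}$. Define $$\Psi_1(r)=\arccos\left[\frac{\sqrt{D_e}\,(T^2-1)+T\sqrt{r-D_e(1-T^2)}}{\sqrt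 r}\right],$$ $$E_1(\lambda,D_e)=\min_{D_ee^{-2\lambda}<r\le \frac{D_ee^{-2\lambda}}{1-e^{-2\lambda}}}\ \frac12\left[\frac r{\sigma^2}-\ln\frac r{\sigma^2}-2\ln\sin\Psi_1(r)-1\right],$$ $$E_2(\lambda,D_e)=\begin{cases}0,&\frac{D_ee^{-2\lambda}}{1-e^{-2\lambda}}\le\sigma^2,\\[4pt] \frac12\left[\frac{D_ee^{-2\lambda}}{(1-e^{-2\lambda})\sigma^2}-\ln\left(\frac{D_ee^{-2\lambda}}{(1-e^{-2\lambda})\sigma^2}\right)-1\right],&\text{otherwise.}\end{cases}$$ Then the minimum defining $E_1$ is attained, the limits $E_{fn}^{ae}(\lambda,D_e)=\lim_{n\to\infty}-\frac1n\ln P^{ae}_{n}$ and $E_{fn}^{se}(\lambda,D_e)=\lim_{n\to\infty}-\frac1n\ln P^{se}_{n}$ exist, and $$E_{fn}^{ae}(\lambda,D_e)=\min\{E_1(\lambda,D_e),E_2(\lambda,D_e)\},\qquad E_{fn}^{se}(\lambda,D_e)=E_2(\lambda,D_e).$$ Moreover $E_{fn}^{ae}(\lambda,D_e)<E_{fn}^{se}(\lambda,D_e)$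 whenever $\frac{D_ee^{-2\lambda}}{1-e^{-2\lambda}}>\sigma^2$; that is, the additive embedder is then strictly outperformed, in the exponential sense, by the sign embedder. -/

import Mathlib

open Real Set Filter Topology MeasureTheory ProbabilityTheory

noncomputable section

namespace Watermark

/-- The law of the covertext: `n` independent `N(0, σ²)` components. -/
def covertextLaw (σ : ℝ) (n : ℕ) : Measure (Fin n → ℝ) :=
  Measure.pi fun _ => gaussianReal 0 (Real.toNNReal (σ ^ 2))

/-- The Euclidean inner product on `ℝⁿ`. -/
def innerProd {n : ℕ} (a b : Fin n → ℝ) : ℝ := ∑ i, a i * b i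

/-- The Euclidean norm on `ℝⁿ`. -/
def norm₂ {n : ℕ} (a : Fin n → ℝ) : ℝ := √(innerProd a a)

/-- The normalized correlation `⟨u, y⟩ / (‖u‖ ‖y‖)`. -/
def normCorr {n : ℕ} (u y : Fin n → ℝ) : ℝ := innerProd u y / (norm₂ u * norm₂ y)

/-- The signum function with the convention `sgn 0 = 1`. -/
def sgn (t : ℝ) : ℝ := if 0 ≤ t then 1 else -1

/-- The additive embedder `y = x + √De u`. -/
def additiveEmbedder (De : ℝ) {n : ℕ} (x u : Fin n → ℝ) : Fin n → ℝ :=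
  fun i => x i + √De * u i

/-- The sign embedder `y = x + sgn(ρ) √De u`, where `ρ = (1/n) ∑ xᵢ uᵢ`. -/
def signEmbedder (De : ℝ) {n : ℕ} (x u : Fin n → ℝ) : Fin n → ℝ :=
  fun i => x i + sgn ((1 / (n : ℝ)) * innerProd x u) * √De * u i

/-- The threshold `T = √(1 - e^{-2λ})` of the normalized-correlation detector. -/
def threshold (lam : ℝ) : ℝ := √(1 - exp (-2 * lam))

/-- False-negative probability of the additive embedder: the detector misses the watermark
when the normalized correlation does not exceed the threshold. -/
def additiveFN (σ lam De : ℝ) {n : ℕ} (u : Fin n → ℝ) : ℝ :=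
  (covertextLaw σ n).real {x | normCorr u (additiveEmbedder De x u) ≤ threshold lam}

/-- False-negative probability of the sign embedder: the detector misses the watermark when
the squared normalized correlation does not exceed `1 - e^{-2λ}`. -/
def signFN (σ lam De : ℝ) {n : ℕ} (u : Fin n → ℝ) : ℝ :=
  (covertextLaw σ n).real
    {x | normCorr u (signEmbedder De x u) ^ 2 ≤ 1 - exp (-2 * lam)}

/-- `E = lim -(1/n) ln pₙ`. The probabilities are required to be eventually positive, so that
the junk value `ln 0 = 0` plays no role. -/
def HasExponent (p : ℕ → ℝ) (E : ℝ) : Prop :=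
  (∀ᶠ n in atTop, 0 < p n) ∧
    Tendsto (fun n : ℕ => -(1 / (n : ℝ)) * Real.log (p n)) atTop (𝓝 E)

/-- The angle `Ψ₁(r)`. -/
def Psi₁ (lam De r : ℝ) : ℝ :=
  arccos ((√De * (threshold lam ^ 2 - 1)
    + threshold lam * √(r - De * (1 - threshold lam ^ 2))) / √r)

/-- The function minimized in the definition of `E₁`. -/
def rate₁ (σ lam De r : ℝ) : ℝ :=
  1 / 2 * (r / σ ^ 2 - Real.log (r / σ ^ 2) - 2 * Real.log (sin (Psi₁ lam De r)) - 1)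

/-- The range of `r` over which `rate₁` is minimized. -/
def range₁ (lam De : ℝ) : Set ℝ :=
  Ioc (De * exp (-2 * lam)) (De * exp (-2 * lam) / (1 - exp (-2 * lam)))

/-- The exponent `E₁`, the infimum of `rate₁` over `range₁`. -/
def E₁ (σ lam De : ℝ) : ℝ := sInf (rate₁ σ lam De '' range₁ lam De)

/-- The exponent `E₂`. -/
def E₂ (σ lam De : ℝ) : ℝ :=
  if De * exp (-2 * lam) / (1 - exp (-2 * lam)) ≤ σ ^ 2 then 0
  else 1 / 2 * (De * exp (-2 * lam) / ((1 - exp (-2 * lam)) * σ ^ 2)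
    - Real.log (De * exp (-2 * lam) / ((1 - exp (-2 * lam)) * σ ^ 2)) - 1)

end Watermark

end

namespace Watermark

/-! Since `u i ^ 2 = 1`, both miss events depend on `x` only through `A = ⟨u,x⟩/n` and `R =
⟨x,x⟩/n`. The density of the covertext law against the product of the `N(u i * a, v)` is `exp (n *
logRatio)`, and `logRatio` is affine in `(A, R)` with value `-gaussRate` at `(a, a² + v)`. Hence a
half-plane bounding `logRatio` above gives an upper bound for every `n` (`covertextLaw_real_le`),
while the law of large numbers under the tilted law gives a lower bound on any open neighbourhood of
`(a, a² + v)` (`eventually_exp_le_of_isOpen`). Each exponent follows from choosing a tilt for which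
the two bounds meet.

Write `s = √De`, `k = exp (-lam)`, `z = s²k²/T²`. The sign miss event forces `R ≥ z`, so the tilt is
`(0, max z σ²)`, with rate `E₂`. The additive miss event is the half-plane `A ≤ -s` together with a
region bounded by a parabola in the `(A, R)` plane. The boundary points with `a = T w / k - s`, `v =
w²` carry `boundaryRate`, which is `rate₁` in another parameter and is strictly convex in `w`. Its
value at `w = k s / T`, where `a = 0`, is `E₂` when `z > σ²`. In that case the minimizer lies
strictly before this end point, which gives `E₁ < E₂`, and the region stays on one side of its
tangent there (`logRatio_le_of_stationary`). When `z ≤ σ²` both exponents are zero. -/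

/-! ### Change of measure between Gaussian product laws -/

theorem pi_withDensity {ι : Type*} [Fintype ι] {Ω : ι → Type*} [∀ i, MeasurableSpace (Ω i)]
    (μ : ∀ i, Measure (Ω i)) [∀ i, IsProbabilityMeasure (μ i)] (f : ∀ i, Ω i → ENNReal)
    (hf : ∀ i, Measurable (f i)) [∀ i, SigmaFinite ((μ i).withDensity (f i))] :
    Measure.pi (fun i => (μ i).withDensity (f i))
      = (Measure.pi μ).withDensity (fun x => ∏ i, f i (x i)) := by
  classical
  refine Measure.pi_eq fun s hs => ?_
  have hm : ∀ i, Measurable ((s i).indicator (f i)) := fun i => (hf i).indicator (hs i)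
  rw [withDensity_apply _ (MeasurableSet.univ_pi hs), ← lintegral_indicator (MeasurableSet.univ_pi hs)]
  have h1 : ∀ x : ∀ i, Ω i, (univ.pi s).indicator (fun x => ∏ i, f i (x i)) x
      = ∏ i, (s i).indicator (f i) (x i) := by
    intro x
    by_cases hx : x ∈ univ.pi s
    · rw [indicator_of_mem hx]
      exact Finset.prod_congr rfl fun i _ => (indicator_of_mem (hx i (mem_univ i)) _).symm
    · rw [indicator_of_notMem hx]
      simp only [Set.mem_pi, mem_univ, true_imp_iff, not_forall] at hx
      obtain ⟨i, hi⟩ := hx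
      exact (Finset.prod_eq_zero (Finset.mem_univ i) (indicator_of_notMem hi _)).symm
  simp_rw [h1]
  have hind := iIndepFun_pi (μ := μ) (X := fun i => (s i).indicator (f i))
    (fun i => (hm i).aemeasurable)
  rw [lintegral_prod_eq_prod_lintegral_of_indepFun _ _ hind
    (fun i => (hm i).comp (measurable_pi_apply i))]
  refine Finset.prod_congr rfl fun i _ => ?_
  rw [withDensity_apply _ (hs i), ← lintegral_indicator (hs i)]
  exact (measurePreserving_eval μ i).lintegral_comp (hm i)

/-- Logarithm of the density of `N(0, v₀)` with respect to `N(m, v)`. -/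
noncomputable def logDensity (v₀ m v x : ℝ) : ℝ :=
  1 / 2 * Real.log (v / v₀) - x ^ 2 / (2 * v₀) + (x - m) ^ 2 / (2 * v)

theorem gaussianReal_eq_withDensity {v₀ v : ℝ} (hv₀ : 0 < v₀) (hv : 0 < v) (m : ℝ) :
    gaussianReal 0 v₀.toNNReal
      = (gaussianReal m v.toNNReal).withDensity
          (fun x => ENNReal.ofReal (exp (logDensity v₀ m v x))) := by
  have h0 : v₀.toNNReal ≠ 0 := by simpa using hv₀
  have h1 : v.toNNReal ≠ 0 := by simpa using hv
  rw [gaussianReal_of_var_ne_zero _ h0, gaussianReal_of_var_ne_zero _ h1,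
    ← withDensity_mul _ (measurable_gaussianPDF _ _) (by unfold logDensity; fun_prop)]
  congr 1
  ext x
  rw [Pi.mul_apply, gaussianPDF_def, gaussianPDF_def,
    ← ENNReal.ofReal_mul (gaussianPDFReal_nonneg _ _ _)]
  simp only [gaussianPDFReal_def, Real.coe_toNNReal _ hv₀.le, Real.coe_toNNReal _ hv.le]
  have h2 : (√(2 * π * v₀))⁻¹ = (√(2 * π * v))⁻¹ * exp (1 / 2 * Real.log (v / v₀)) := by
    rw [← Real.log_rpow (by positivity) , Real.exp_log (by positivity), ← Real.sqrt_eq_rpow,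
      Real.sqrt_div hv.le, Real.sqrt_mul (by positivity), Real.sqrt_mul (by positivity) v]
    have := Real.sqrt_pos.2 hv
    have := Real.sqrt_pos.2 hv₀
    have : 0 < √(2 * π) := by positivity
    field_simp
  rw [h2, mul_assoc _ (exp _), mul_assoc _ (exp _), ← Real.exp_add, ← Real.exp_add, logDensity]
  congr 3
  ring

/-- The large-deviation rate of a sample with empirical mean `a` and empirical variance `v`. -/
noncomputable def gaussRate (v₀ a v : ℝ) : ℝ := 1 / 2 * ((a ^ 2 + v) / v₀ - Real.log (v / v₀) - 1)

/-- Normalized log-likelihood ratio of `N(0, v₀)` against `N(a, v)` at a sample with first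
empirical moment `A` and second empirical moment `R`. -/
noncomputable def logRatio (v₀ a v A R : ℝ) : ℝ :=
  -gaussRate v₀ a v + (R - (a ^ 2 + v)) * (1 / (2 * v) - 1 / (2 * v₀)) - a * (A - a) / v

/-- The product of the laws `N(uᵢ a, v)`. -/
noncomputable def tiltedLaw {n : ℕ} (u : Fin n → ℝ) (a v : ℝ) : Measure (Fin n → ℝ) :=
  Measure.pi fun i => gaussianReal (u i * a) v.toNNReal

instance {n : ℕ} (u : Fin n → ℝ) (a v : ℝ) : IsProbabilityMeasure (tiltedLaw u a v) := by
  unfold tiltedLaw; infer_instance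

instance (σ : ℝ) (n : ℕ) : IsProbabilityMeasure (covertextLaw σ n) := by
  unfold covertextLaw; infer_instance

theorem measurable_innerProd_left {n : ℕ} (u : Fin n → ℝ) : Measurable fun x => innerProd u x := by
  unfold innerProd; fun_prop

theorem measurable_innerProd_self {n : ℕ} : Measurable fun x : Fin n → ℝ => innerProd x x := by
  unfold innerProd; fun_prop

theorem measurableSet_moments {n : ℕ} (u : Fin n → ℝ) (a b δ : ℝ) :
    MeasurableSet {x : Fin n → ℝ | |innerProd u x / n - a| < δ ∧ |innerProd x x / n - b| < δ} := by
  have := measurable_innerProd_left u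
  have := measurable_innerProd_self (n := n)
  have h1 : Measurable fun x : Fin n → ℝ => |innerProd u x / n - a| := by fun_prop
  have h2 : Measurable fun x : Fin n → ℝ => |innerProd x x / n - b| := by fun_prop
  exact (measurableSet_lt h1 measurable_const).inter (measurableSet_lt h2 measurable_const)

/-- Expanding `(x i - u i * a) ^ 2` with `u i ^ 2 = 1` leaves only the two empirical moments, so the
signs in `u` enter solely through `⟨u,x⟩`. -/
theorem sum_logDensity {n : ℕ} (hn : n ≠ 0) {u : Fin n → ℝ} (hu : ∀ i, u i = 1 ∨ u i = -1)
    {v₀ v : ℝ} (hv₀ : 0 < v₀) (hv : 0 < v) (a : ℝ) (x : Fin n → ℝ) :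
    ∑ i, logDensity v₀ (u i * a) v (x i)
      = n * logRatio v₀ a v (innerProd u x / n) (innerProd x x / n) := by
  have hu2 : ∀ i, u i ^ 2 = 1 := fun i => by rcases hu i with h | h <;> rw [h] <;> norm_num
  have h1 : ∀ i, logDensity v₀ (u i * a) v (x i)
      = (1 / 2 * Real.log (v / v₀) + a ^ 2 / (2 * v)) + (1 / (2 * v) - 1 / (2 * v₀)) * (x i * x i)
        - a / v * (u i * x i) := by
    intro i
    have : (x i - u i * a) ^ 2 = x i * x i - 2 * a * (u i * x i) + a ^ 2 := by
      linear_combination a ^ 2 * hu2 i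
    rw [logDensity, this]
    field_simp
    ring
  simp_rw [h1, Finset.sum_sub_distrib, Finset.sum_add_distrib, ← Finset.mul_sum]
  have hn' : (n : ℝ) ≠ 0 := by exact_mod_cast hn
  rw [logRatio, gaussRate]
  change _ + _ * innerProd x x - _ * innerProd u x = _
  simp only [Finset.sum_const, Finset.card_univ, Fintype.card_fin, nsmul_eq_mul]
  field_simp
  ring

theorem covertextLaw_eq_withDensity {n : ℕ} (hn : n ≠ 0) {u : Fin n → ℝ}
    (hu : ∀ i, u i = 1 ∨ u i = -1) {σ v : ℝ} (hσ : 0 < σ) (hv : 0 < v) (a : ℝ) :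
    covertextLaw σ n = (tiltedLaw u a v).withDensity (fun x => ENNReal.ofReal
      (exp (n * logRatio (σ ^ 2) a v (innerProd u x / n) (innerProd x x / n)))) := by
  have hσ2 : 0 < σ ^ 2 := by positivity
  have key := fun i => gaussianReal_eq_withDensity hσ2 hv (u i * a)
  have h : covertextLaw σ n = Measure.pi (fun i => (gaussianReal (u i * a) v.toNNReal).withDensity
          (fun x => ENNReal.ofReal (exp (logDensity (σ ^ 2) (u i * a) v x)))) := by
    rw [covertextLaw]; congr 1; ext1 i; exact key i
  have : ∀ i, SigmaFinite ((gaussianReal (u i * a) v.toNNReal).withDensity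
          (fun x => ENNReal.ofReal (exp (logDensity (σ ^ 2) (u i * a) v x)))) := fun i => by
    rw [← key i]; infer_instance
  rw [h, pi_withDensity _ _ (fun i => by unfold logDensity; fun_prop), tiltedLaw]
  congr 1
  ext x
  rw [← sum_logDensity hn hu hσ2 hv, Real.exp_sum, ENNReal.ofReal_prod_of_nonneg]
  exact fun i _ => (exp_pos _).le

/-- The upper half of the method: the density is at most `exp (-(n * c))` on `F`, and the tilted law
has total mass one. -/
theorem covertextLaw_real_le {n : ℕ} (hn : n ≠ 0) {u : Fin n → ℝ}
    (hu : ∀ i, u i = 1 ∨ u i = -1) {σ v : ℝ} (hσ : 0 < σ) (hv : 0 < v) (a c : ℝ)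
    (F : Set (Fin n → ℝ))
    (hF : ∀ x ∈ F, logRatio (σ ^ 2) a v (innerProd u x / n) (innerProd x x / n) ≤ -c) :
    (covertextLaw σ n).real F ≤ exp (-(n * c)) := by
  refine ENNReal.toReal_le_of_le_ofReal (exp_pos _).le ?_
  rw [covertextLaw_eq_withDensity hn hu hσ hv a, withDensity_apply' _ F]
  set g : (Fin n → ℝ) → ℝ := fun x =>
    exp (n * logRatio (σ ^ 2) a v (innerProd u x / n) (innerProd x x / n)) with hg
  -- `F` need not be measurable, so it is enlarged to the sublevel set of the density.
  set G : Set (Fin n → ℝ) := {x | g x ≤ exp (-(n * c))} with hG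
  have hgm : Measurable g := by
    have := measurable_innerProd_left u
    have := measurable_innerProd_self (n := n)
    rw [hg]; unfold logRatio; fun_prop
  have hGm : MeasurableSet G := measurableSet_le hgm measurable_const
  have hFG : F ⊆ G := fun x hx => by
    refine Real.exp_le_exp.2 ?_
    have := mul_le_mul_of_nonneg_left (hF x hx) (Nat.cast_nonneg (α := ℝ) n)
    linarith
  calc ∫⁻ x in F, ENNReal.ofReal (g x) ∂tiltedLaw u a v
      ≤ ∫⁻ x in G, ENNReal.ofReal (g x) ∂tiltedLaw u a v := lintegral_mono_set hFG
    _ ≤ ∫⁻ x in G, ENNReal.ofReal (exp (-(n * c))) ∂tiltedLaw u a v :=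
        setLIntegral_mono measurable_const fun x hx => ENNReal.ofReal_le_ofReal hx
    _ = ENNReal.ofReal (exp (-(n * c))) * tiltedLaw u a v G := by simp
    _ ≤ ENNReal.ofReal (exp (-(n * c))) := mul_le_of_le_one_right' prob_le_one

theorem le_covertextLaw_real {n : ℕ} (hn : n ≠ 0) {u : Fin n → ℝ}
    (hu : ∀ i, u i = 1 ∨ u i = -1) {σ v : ℝ} (hσ : 0 < σ) (hv : 0 < v) (a c : ℝ)
    {G : Set (Fin n → ℝ)} (hGm : MeasurableSet G)
    (hG : ∀ x ∈ G, -c ≤ logRatio (σ ^ 2) a v (innerProd u x / n) (innerProd x x / n)) :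
    exp (-(n * c)) * (tiltedLaw u a v).real G ≤ (covertextLaw σ n).real G := by
  have h : ENNReal.ofReal (exp (-(n * c))) * tiltedLaw u a v G ≤ covertextLaw σ n G := by
    rw [covertextLaw_eq_withDensity hn hu hσ hv a, withDensity_apply' _ G]
    calc ENNReal.ofReal (exp (-(n * c))) * tiltedLaw u a v G
        = ∫⁻ x in G, ENNReal.ofReal (exp (-(n * c))) ∂tiltedLaw u a v := by simp
      _ ≤ _ := by
        refine setLIntegral_mono' hGm fun x hx => ENNReal.ofReal_le_ofReal (Real.exp_le_exp.2 ?_)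
        have := mul_le_mul_of_nonneg_left (hG x hx) (Nat.cast_nonneg (α := ℝ) n)
        linarith
  have h2 := ENNReal.toReal_mono (measure_ne_top _ _) h
  rwa [ENNReal.toReal_mul, ENNReal.toReal_ofReal (exp_pos _).le] at h2

/-! ### Law of large numbers and the exponential lower bound -/

/-- Chebyshev's inequality for the empirical mean of independent coordinates. -/
theorem pi_real_mean_deviation_le {n : ℕ} (hn : n ≠ 0) (μ : Fin n → Measure ℝ)
    [∀ i, IsProbabilityMeasure (μ i)] {f : Fin n → ℝ → ℝ} (hf : ∀ i, MemLp (f i) 2 (μ i))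
    {m C δ : ℝ} (hδ : 0 < δ) (hm : ∀ i, ∫ x, f i x ∂μ i = m) (hC : ∀ i, Var[f i; μ i] ≤ C) :
    (Measure.pi μ).real {x | δ ≤ |(∑ i, f i (x i)) / n - m|} ≤ C / (n * δ ^ 2) := by
  have hn' : (0 : ℝ) < n := by positivity
  have hmem : ∀ i, MemLp (fun x : Fin n → ℝ => f i (x i)) 2 (Measure.pi μ) :=
    fun i => (hf i).comp_measurePreserving (measurePreserving_eval _ i)
  have hS : MemLp (∑ i, fun x : Fin n → ℝ => f i (x i)) 2 (Measure.pi μ) :=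
    memLp_finsetSum' _ fun i _ => hmem i
  have hE : ∫ x, (∑ i, fun x : Fin n → ℝ => f i (x i)) x ∂Measure.pi μ = n * m := by
    simp_rw [Finset.sum_apply]
    rw [integral_finsetSum _ fun i _ => (hmem i).integrable (by norm_num)]
    have : ∀ i, ∫ x, f i (x i) ∂Measure.pi μ = m := fun i => by
      rw [← hm i]
      have h := (measurePreserving_eval μ i)
      have h2 := integral_map (μ := Measure.pi μ) (φ := Function.eval i) (f := f i)
        h.measurable.aemeasurable (by rw [h.map_eq]; exact (hf i).1)
      rw [h.map_eq] at h2
      exact h2.symm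
    simp [this]
  have hV := variance_sum_pi (μ := μ) hf
  have hVC : Var[∑ i, fun x : Fin n → ℝ => f i (x i); Measure.pi μ] ≤ n * C := by
    rw [hV]
    calc ∑ i, Var[f i; μ i] ≤ ∑ _i : Fin n, C := Finset.sum_le_sum fun i _ => hC i
      _ = n * C := by simp
  have hch := meas_ge_le_variance_div_sq hS (c := n * δ) (by positivity)
  rw [hE] at hch
  have h3 := ENNReal.toReal_le_of_le_ofReal (div_nonneg (variance_nonneg _ _) (by positivity)) hch
  have hset : {x : Fin n → ℝ | δ ≤ |(∑ i, f i (x i)) / n - m|}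
      = {ω | n * δ ≤ |(∑ i, fun x : Fin n → ℝ => f i (x i)) ω - n * m|} := by
    ext x
    simp only [Set.mem_ofPred_eq, Finset.sum_apply]
    have : (∑ i, f i (x i)) - n * m = n * ((∑ i, f i (x i)) / n - m) := by field_simp
    rw [this, abs_mul, abs_of_pos hn', mul_le_mul_iff_right₀ hn']
  rw [hset]
  refine h3.trans ?_
  calc _ ≤ n * C / (n * δ) ^ 2 := by gcongr
    _ = C / (n * δ ^ 2) := by field_simp

theorem memLp_gaussianReal_const_mul (m c : ℝ) (v : NNReal) :
    MemLp (fun x => c * x) 2 (gaussianReal m v) :=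
  (memLp_id_gaussianReal (μ := m) (v := v) 2).const_mul c

theorem memLp_gaussianReal_sq (m : ℝ) (v : NNReal) :
    MemLp (fun x : ℝ => x * x) 2 (gaussianReal m v) := by
  have h4 : MemLp (fun x : ℝ => x) 4 (gaussianReal m v) := memLp_id_gaussianReal (μ := m) (v := v) 4
  have : ENNReal.HolderTriple 4 4 2 := ⟨by
    have h : (4 : ENNReal) = 2 * 2 := by norm_num
    rw [h, ENNReal.mul_inv (by simp) (by simp), ← mul_add, ENNReal.inv_two_add_inv_two, mul_one]⟩
  exact h4.mul h4

theorem integral_gaussianReal_sq (m : ℝ) (v : NNReal) :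
    ∫ x, x * x ∂gaussianReal m v = m ^ 2 + v := by
  have h := variance_eq_sub (memLp_id_gaussianReal (μ := m) (v := v) 2)
  rw [variance_id_gaussianReal] at h
  simp only [Pi.pow_apply, id_eq, integral_id_gaussianReal] at h
  simp_rw [← sq]
  linarith

/-- Weak law of large numbers for the empirical first and second moments under the tilted law. -/
theorem eventually_half_le_tiltedLaw (u : ∀ n : ℕ, Fin n → ℝ)
    (hu : ∀ (n : ℕ) (i : Fin n), u n i = 1 ∨ u n i = -1) (a : ℝ) {v δ : ℝ} (hv : 0 < v)
    (hδ : 0 < δ) :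
    ∀ᶠ n : ℕ in atTop, 1 / 2 ≤ (tiltedLaw (u n) a v).real
      {x | |innerProd (u n) x / n - a| < δ ∧ |innerProd x x / n - (a ^ 2 + v)| < δ} := by
  set V : ℝ → ℝ := fun m => Var[fun x : ℝ => x * x; gaussianReal m v.toNNReal]
  -- The coordinate means are `a` or `-a`, so one constant bounds the variances of `u i * x` and of
  -- `x * x` for all signs.
  set C : ℝ := max v (max (V a) (V (-a))) with hCdef
  have hlim : Tendsto (fun n : ℕ => C / (n * δ ^ 2)) atTop (𝓝 0) :=
    tendsto_const_nhds.div_atTop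
      (tendsto_natCast_atTop_atTop.atTop_mul_const (by positivity))
  filter_upwards [hlim.eventually_le_const (by norm_num : (0 : ℝ) < 1 / 4),
    eventually_ne_atTop 0] with n hC hn
  have hu2 : ∀ i, u n i ^ 2 = 1 := fun i => by rcases hu n i with h | h <;> rw [h] <;> norm_num
  have h1 := pi_real_mean_deviation_le hn (fun i => gaussianReal (u n i * a) v.toNNReal)
    (f := fun i x => u n i * x) (fun i => memLp_gaussianReal_const_mul _ _ _)
    (m := a) (C := C) hδ
    (fun i => by
      rw [integral_const_mul, integral_id_gaussianReal]
      linear_combination a * hu2 i)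
    (fun i => by
      rw [variance_const_mul, variance_fun_id_gaussianReal, hu2, one_mul, Real.coe_toNNReal _ hv.le]
      exact le_max_left _ _)
  have h2 := pi_real_mean_deviation_le hn (fun i => gaussianReal (u n i * a) v.toNNReal)
    (f := fun i x => x * x) (fun i => memLp_gaussianReal_sq _ _)
    (m := a ^ 2 + v) (C := C) hδ
    (fun i => by
      rw [integral_gaussianReal_sq, Real.coe_toNNReal _ hv.le]
      linear_combination a ^ 2 * hu2 i)
    (fun i => by
      rcases hu n i with h | h <;> rw [h]
      · rw [one_mul]; exact (le_max_left _ _).trans (le_max_right _ _)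
      · rw [neg_one_mul]; exact (le_max_right _ _).trans (le_max_right _ _))
  set G := {x : Fin n → ℝ |
    |innerProd (u n) x / n - a| < δ ∧ |innerProd x x / n - (a ^ 2 + v)| < δ} with hG
  have hGm : MeasurableSet G := measurableSet_moments _ _ _ _
  have hGc : (tiltedLaw (u n) a v).real Gᶜ ≤ 1 / 4 + 1 / 4 := by
    refine (measureReal_mono ?_).trans ((measureReal_union_le _ _).trans
      (add_le_add (h1.trans hC) (h2.trans hC)))
    intro x hx
    rw [hG, mem_compl_iff, Set.mem_ofPred_eq, not_and_or, not_lt, not_lt] at hx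
    exact hx
  rw [probReal_compl_eq_one_sub hGm] at hGc
  linarith

/-- The tilted law gives mass at least one half to moments near `(a, a² + v)`, where `logRatio` is
close to `-gaussRate`. Half of `ε` pays for this variation, the other half for the factor one half.
-/
theorem eventually_exp_le_covertextLaw (u : ∀ n : ℕ, Fin n → ℝ)
    (hu : ∀ (n : ℕ) (i : Fin n), u n i = 1 ∨ u n i = -1) {σ a v δ : ℝ} (hσ : 0 < σ) (hv : 0 < v)
    (hδ : 0 < δ) (F : ∀ n : ℕ, Set (Fin n → ℝ))
    (hF : ∀ n : ℕ, n ≠ 0 → ∀ x : Fin n → ℝ, |innerProd (u n) x / n - a| < δ →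
      |innerProd x x / n - (a ^ 2 + v)| < δ → x ∈ F n) {ε : ℝ} (hε : 0 < ε) :
    ∀ᶠ n : ℕ in atTop, exp (-(n * (gaussRate (σ ^ 2) a v + ε))) ≤ (covertextLaw σ n).real (F n) := by
  -- `K` is a Lipschitz constant of `logRatio` in `(A, R)`; `δ'` keeps its variation below `ε / 2`.
  set K : ℝ := |1 / (2 * v) - 1 / (2 * σ ^ 2)| + |a / v| with hK
  have hK0 : 0 ≤ K := by positivity
  set δ' : ℝ := min δ (ε / (2 * (K + 1))) with hδ'
  have hδ'0 : 0 < δ' := lt_min hδ (by positivity)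
  have hδK : δ' * K ≤ ε / 2 := by
    calc δ' * K ≤ ε / (2 * (K + 1)) * (K + 1) :=
          mul_le_mul (min_le_right _ _) (by linarith) hK0 (by positivity)
      _ = ε / 2 := by field_simp
  have hexp : ∀ᶠ n : ℕ in atTop, exp (-(n * (ε / 2))) ≤ 1 / 2 := by
    have h : Tendsto (fun n : ℕ => exp (-(n * (ε / 2)))) atTop (𝓝 0) :=
      tendsto_exp_neg_atTop_nhds_zero.comp
        (tendsto_natCast_atTop_atTop.atTop_mul_const (by positivity))
    exact h.eventually_le_const (by norm_num)
  filter_upwards [eventually_half_le_tiltedLaw u hu a hv hδ'0, hexp, eventually_ne_atTop 0]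
    with n hn he hn0
  set G := {x : Fin n → ℝ |
    |innerProd (u n) x / n - a| < δ' ∧ |innerProd x x / n - (a ^ 2 + v)| < δ'} with hG
  have hGm : MeasurableSet G := measurableSet_moments _ _ _ _
  have hlow := le_covertextLaw_real hn0 (hu n) hσ hv a (gaussRate (σ ^ 2) a v + ε / 2) hGm (by
    rintro x ⟨hA, hR⟩
    rw [logRatio]
    generalize innerProd (u n) x / n = A at *
    generalize innerProd x x / n = R at *
    have e1 : |(R - (a ^ 2 + v)) * (1 / (2 * v) - 1 / (2 * σ ^ 2))|
        ≤ δ' * |1 / (2 * v) - 1 / (2 * σ ^ 2)| := by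
      rw [abs_mul]; exact mul_le_mul_of_nonneg_right hR.le (abs_nonneg _)
    have e2 : |a * (A - a) / v| ≤ δ' * |a / v| := by
      rw [mul_comm a, mul_div_assoc, abs_mul]
      exact mul_le_mul_of_nonneg_right hA.le (abs_nonneg _)
    have e3 : δ' * |1 / (2 * v) - 1 / (2 * σ ^ 2)| + δ' * |a / v| = δ' * K := by rw [hK]; ring
    have := (abs_le.1 e1).1
    have := (abs_le.1 e2).2
    linarith)
  calc exp (-(n * (gaussRate (σ ^ 2) a v + ε)))
      = exp (-(n * (gaussRate (σ ^ 2) a v + ε / 2))) * exp (-(n * (ε / 2))) := by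
        rw [← Real.exp_add]; congr 1; ring
    _ ≤ exp (-(n * (gaussRate (σ ^ 2) a v + ε / 2))) * (tiltedLaw (u n) a v).real G :=
        mul_le_mul_of_nonneg_left (he.trans hn) (exp_pos _).le
    _ ≤ (covertextLaw σ n).real G := hlow
    _ ≤ (covertextLaw σ n).real (F n) := measureReal_mono fun x hx =>
        hF n hn0 x (hx.1.trans_le (min_le_left _ _)) (hx.2.trans_le (min_le_left _ _))

/-- The factor 2 leaves room for a union of two events and costs only `log 2 / n`. -/
theorem HasExponent.of_bounds {p : ℕ → ℝ} {E : ℝ}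
    (hlow : ∀ ε > 0, ∀ᶠ n : ℕ in atTop, exp (-(n * (E + ε))) ≤ p n)
    (hup : ∀ᶠ n : ℕ in atTop, p n ≤ 2 * exp (-(n * E))) : HasExponent p E := by
  have hpos : ∀ᶠ n in atTop, 0 < p n := (hlow 1 one_pos).mono fun n h => (exp_pos _).trans_le h
  refine ⟨hpos, ?_⟩
  have hlim : Tendsto (fun n : ℕ => Real.log 2 / n) atTop (𝓝 0) :=
    tendsto_const_nhds.div_atTop tendsto_natCast_atTop_atTop
  rw [Metric.tendsto_nhds]
  intro ε hε
  filter_upwards [hlow (ε / 2) (by positivity), hup, hpos, eventually_ne_atTop 0,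
    hlim.eventually_lt_const hε] with n h1 h2 h3 h4 h5
  have hn : (0 : ℝ) < n := by positivity
  have g1 := (Real.le_log_iff_exp_le h3).2 h1
  have g2 := Real.log_le_log h3 h2
  rw [Real.log_mul (by norm_num) (exp_pos _).ne', Real.log_exp] at g2
  set l := Real.log (p n)
  rw [div_lt_iff₀ hn] at h5
  have e : -(1 / (n : ℝ)) * l - E = (-l - n * E) / n := by field_simp
  rw [Real.dist_eq, e, abs_lt, lt_div_iff₀ hn, div_lt_iff₀ hn]
  have := mul_pos hn hε
  constructor <;> nlinarith

theorem eventually_exp_le_of_isOpen (u : ∀ n : ℕ, Fin n → ℝ)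
    (hu : ∀ (n : ℕ) (i : Fin n), u n i = 1 ∨ u n i = -1) {σ a v : ℝ} (hσ : 0 < σ) (hv : 0 < v)
    {U : Set (ℝ × ℝ)} (hU : IsOpen U) (hmem : (a, a ^ 2 + v) ∈ U) (F : ∀ n : ℕ, Set (Fin n → ℝ))
    (hF : ∀ n : ℕ, n ≠ 0 → ∀ x : Fin n → ℝ,
      (innerProd (u n) x / n, innerProd x x / n) ∈ U → x ∈ F n) {ε : ℝ} (hε : 0 < ε) :
    ∀ᶠ n : ℕ in atTop, exp (-(n * (gaussRate (σ ^ 2) a v + ε))) ≤ (covertextLaw σ n).real (F n) := by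
  obtain ⟨δ, hδ, hball⟩ := Metric.isOpen_iff.1 hU _ hmem
  refine eventually_exp_le_covertextLaw u hu hσ hv hδ F (fun n hn x hA hR => hF n hn x (hball ?_)) hε
  rw [Metric.mem_ball, Prod.dist_eq, max_lt_iff, Real.dist_eq, Real.dist_eq]
  exact ⟨hA, hR⟩

/-! ### Miss events in terms of the empirical moments -/

section Correlation

variable {n : ℕ} {u : Fin n → ℝ}

theorem innerProd_self_nonneg (x : Fin n → ℝ) : 0 ≤ innerProd x x :=
  Finset.sum_nonneg fun i _ => mul_self_nonneg (x i)

theorem innerProd_comm (x y : Fin n → ℝ) : innerProd x y = innerProd y x :=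
  Finset.sum_congr rfl fun _ _ => mul_comm _ _

theorem innerProd_sign_self (hu : ∀ i, u i = 1 ∨ u i = -1) : innerProd u u = n := by
  have : ∀ i, u i * u i = 1 := fun i => by rcases hu i with h | h <;> rw [h] <;> norm_num
  simp [innerProd, this]

theorem innerProd_embed (hn : n ≠ 0) (hu : ∀ i, u i = 1 ∨ u i = -1) (x : Fin n → ℝ) (q : ℝ) :
    innerProd u (fun i => x i + q * u i) = n * (innerProd u x / n + q) := by
  have hn' : (n : ℝ) ≠ 0 := by exact_mod_cast hn
  have h : innerProd u (fun i => x i + q * u i) = innerProd u x + q * innerProd u u := by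
    simp only [innerProd, Finset.mul_sum, ← Finset.sum_add_distrib]
    exact Finset.sum_congr rfl fun i _ => by ring
  rw [h, innerProd_sign_self hu]
  field_simp

theorem innerProd_embed_self (hn : n ≠ 0) (hu : ∀ i, u i = 1 ∨ u i = -1) (x : Fin n → ℝ) (q : ℝ) :
    innerProd (fun i => x i + q * u i) (fun i => x i + q * u i)
      = n * ((innerProd u x / n + q) ^ 2 + (innerProd x x / n - (innerProd u x / n) ^ 2)) := by
  have hn' : (n : ℝ) ≠ 0 := by exact_mod_cast hn
  have h : innerProd (fun i => x i + q * u i) (fun i => x i + q * u i)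
      = innerProd x x + 2 * q * innerProd u x + q ^ 2 * innerProd u u := by
    simp only [innerProd, Finset.mul_sum, ← Finset.sum_add_distrib]
    exact Finset.sum_congr rfl fun i _ => by ring
  rw [h, innerProd_sign_self hu]
  field_simp
  ring

theorem sq_mean_le (hn : n ≠ 0) (hu : ∀ i, u i = 1 ∨ u i = -1) (x : Fin n → ℝ) :
    0 ≤ innerProd x x / n - (innerProd u x / n) ^ 2 := by
  have hn' : (0 : ℝ) < n := by positivity
  have h := innerProd_self_nonneg (fun i => x i + (-(innerProd u x / n)) * u i)
  rw [innerProd_embed_self hn hu, mul_nonneg_iff_of_pos_left hn'] at h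
  simpa using h

theorem normCorr_embed (hn : n ≠ 0) (hu : ∀ i, u i = 1 ∨ u i = -1) (x : Fin n → ℝ) (q : ℝ) :
    normCorr u (fun i => x i + q * u i) = (innerProd u x / n + q)
      / √((innerProd u x / n + q) ^ 2 + (innerProd x x / n - (innerProd u x / n) ^ 2)) := by
  have hn' : (0 : ℝ) < n := by positivity
  rw [normCorr, norm₂, norm₂, innerProd_embed hn hu, innerProd_embed_self hn hu,
    innerProd_sign_self hu, Real.sqrt_mul hn'.le, ← mul_assoc, Real.mul_self_sqrt hn'.le,
    mul_div_mul_left _ _ hn'.ne']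

theorem moments_of_normCorr_additive_le (hn : n ≠ 0) (hu : ∀ i, u i = 1 ∨ u i = -1) {De T : ℝ}
    {x : Fin n → ℝ} (h : normCorr u (additiveEmbedder De x u) ≤ T) :
    innerProd u x / n ≤ -√De ∨ (1 - T ^ 2) * (innerProd u x / n + √De) ^ 2
      ≤ T ^ 2 * (innerProd x x / n - (innerProd u x / n) ^ 2) := by
  unfold additiveEmbedder at h
  rw [normCorr_embed hn hu] at h
  have hV := sq_mean_le hn hu x
  set A := innerProd u x / n
  set V := innerProd x x / n - A ^ 2
  rcases le_or_gt (A + √De) 0 with h0 | h0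
  · left; linarith
  · right
    have hN : 0 < (A + √De) ^ 2 + V := by positivity
    rw [div_le_iff₀ (Real.sqrt_pos.2 hN)] at h
    have h2 := pow_le_pow_left₀ h0.le h 2
    rw [mul_pow, Real.sq_sqrt hN.le] at h2
    linarith

theorem normCorr_additive_le (hn : n ≠ 0) (hu : ∀ i, u i = 1 ∨ u i = -1) {De T : ℝ}
    (hT : 0 ≤ T) {x : Fin n → ℝ} (h : innerProd u x / n + √De
      ≤ T * √((innerProd u x / n + √De) ^ 2 + (innerProd x x / n - (innerProd u x / n) ^ 2))) :
    normCorr u (additiveEmbedder De x u) ≤ T := by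
  unfold additiveEmbedder
  rw [normCorr_embed hn hu]
  -- A zero denominator makes the quotient 0, which is at most `T`.
  exact div_le_of_le_mul₀ (Real.sqrt_nonneg _) hT h

theorem sgn_mul_self (t : ℝ) : sgn t * sgn t = 1 := by
  unfold sgn; split_ifs <;> norm_num

theorem sgn_mul_eq_abs (t : ℝ) : sgn t * t = |t| := by
  unfold sgn
  split_ifs with h
  · rw [abs_of_nonneg h, one_mul]
  · rw [abs_of_neg (not_le.1 h), neg_one_mul]

/-- Embedding with the sign of `A` turns `A + sgn A * √De` into `|A| + √De` up to sign. This is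
positive, so the squared test can be cleared of its denominator in both directions. -/
theorem normCorr_sign_sq_le_iff (hn : n ≠ 0) (hu : ∀ i, u i = 1 ∨ u i = -1) {De τ : ℝ}
    (hDe : 0 < De) {x : Fin n → ℝ} :
    normCorr u (signEmbedder De x u) ^ 2 ≤ τ ↔ (1 - τ) * (|innerProd u x / n| + √De) ^ 2
      ≤ τ * (innerProd x x / n - (innerProd u x / n) ^ 2) := by
  unfold signEmbedder
  rw [normCorr_embed hn hu]
  have hV := sq_mean_le hn hu x
  have hA : 1 / (n : ℝ) * innerProd x u = innerProd u x / n := by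
    rw [innerProd_comm]; ring
  rw [hA]
  set A := innerProd u x / n
  set V := innerProd x x / n - A ^ 2
  have hsq : (A + sgn A * √De) ^ 2 = (|A| + √De) ^ 2 := by
    rw [← sgn_mul_eq_abs A]
    linear_combination (De - A ^ 2) * sgn_mul_self A + (sgn A * sgn A - 1) * Real.sq_sqrt hDe.le
  have hs := Real.sqrt_pos.2 hDe
  have hN : 0 < (|A| + √De) ^ 2 + V := by positivity
  rw [div_pow, hsq, Real.sq_sqrt hN.le, div_le_iff₀ hN]
  constructor <;> intro h <;> linarith

end Correlation

/-! ### The rate along the boundary of the additive miss event -/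

theorem gaussRate_nonneg {v₀ v : ℝ} (hv₀ : 0 < v₀) (hv : 0 < v) (a : ℝ) :
    0 ≤ gaussRate v₀ a v := by
  have h1 := Real.log_le_sub_one_of_pos (div_pos hv hv₀)
  have h2 : 0 ≤ a ^ 2 / v₀ := by positivity
  rw [gaussRate, add_div]
  linarith

/-- The rate of the boundary point of the additive miss event with empirical standard deviation
`w`. -/
noncomputable def boundaryRate (σ s T k w : ℝ) : ℝ := gaussRate (σ ^ 2) (T / k * w - s) (w ^ 2)

/-- The rate is a quadratic in `w` minus `log w`. The quadratic part is expanded exactly at `w₀` and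
the logarithm is bounded by its tangent, so the last term on the left carries the derivative at
`w₀`. -/
theorem boundaryRate_lower {σ s T k w w₀ : ℝ} (hσ : 0 < σ) (hk : 0 < k) (hTk : T ^ 2 = 1 - k ^ 2)
    (hw : 0 < w) (hw₀ : 0 < w₀) :
    boundaryRate σ s T k w₀ + (w - w₀) ^ 2 / (2 * k ^ 2 * σ ^ 2)
      + (w - w₀) * ((w₀ / k ^ 2 - s * T / k) / σ ^ 2 - 1 / w₀) ≤ boundaryRate σ s T k w := by
  have hlog := Real.log_le_sub_one_of_pos (div_pos hw hw₀)
  rw [Real.log_div hw.ne' hw₀.ne'] at hlog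
  rw [boundaryRate, boundaryRate, gaussRate, gaussRate,
    Real.log_div (by positivity) (by positivity), Real.log_div (by positivity) (by positivity),
    Real.log_pow, Real.log_pow, Real.log_pow, mul_sub (w - w₀)]
  push_cast
  have hT : (T / k) ^ 2 = 1 / k ^ 2 - 1 := by rw [div_pow, hTk]; field_simp
  have e : ∀ y : ℝ, (T / k * y - s) ^ 2 + y ^ 2 = y ^ 2 / k ^ 2 - 2 * (s * T / k) * y + s ^ 2 := by
    intro y; linear_combination y ^ 2 * hT
  rw [e, e]
  have e2 : 1 / 2 * ((w ^ 2 / k ^ 2 - 2 * (s * T / k) * w + s ^ 2) / σ ^ 2)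
      - 1 / 2 * ((w₀ ^ 2 / k ^ 2 - 2 * (s * T / k) * w₀ + s ^ 2) / σ ^ 2)
      = (w - w₀) ^ 2 / (2 * k ^ 2 * σ ^ 2) + (w - w₀) * ((w₀ / k ^ 2 - s * T / k) / σ ^ 2) := by
    field_simp; ring
  have e3 : (w - w₀) * (1 / w₀) = w / w₀ - 1 := by field_simp
  linarith

section Range

variable {σ lam De : ℝ}

theorem threshold_sq (hlam : 0 < lam) : threshold lam ^ 2 = 1 - exp (-lam) ^ 2 := by
  have h1 : exp (-lam) ^ 2 = exp (-2 * lam) := by rw [← Real.exp_nat_mul]; congr 1; push_cast; ring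
  have h2 : exp (-2 * lam) ≤ 1 := Real.exp_le_one_iff.2 (by linarith)
  rw [threshold, Real.sq_sqrt (by linarith), h1]

theorem exp_neg_two_mul : exp (-2 * lam) = exp (-lam) ^ 2 := by
  rw [← Real.exp_nat_mul]; congr 1; push_cast; ring

theorem threshold_pos (hlam : 0 < lam) : 0 < threshold lam :=
  Real.sqrt_pos.2 (by have : exp (-2 * lam) < 1 := Real.exp_lt_one_iff.2 (by linarith); linarith)

/-- The cosine of `Psi₁` is `a / √r` with `r = a² + w²`, so its sine is `w / √r` and the terms in
`log r` cancel. The parameter `t` is the inner square root in `Psi₁`. -/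
theorem rate₁_eq_boundaryRate (hσ : 0 < σ) (hlam : 0 < lam) (hDe : 0 < De) {t : ℝ} (ht : 0 ≤ t) :
    rate₁ σ lam De (t ^ 2 + De * exp (-lam) ^ 2)
      = boundaryRate σ (√De) (threshold lam) (exp (-lam)) (exp (-lam) * (√De * threshold lam + t)) := by
  have hTk := threshold_sq hlam
  have hT := threshold_pos hlam
  have hk : 0 < exp (-lam) := exp_pos _
  have hs := Real.sqrt_pos.2 hDe
  have hs2 := Real.sq_sqrt hDe.le
  rw [rate₁, Psi₁, boundaryRate, gaussRate]
  generalize threshold lam = T at *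
  generalize exp (-lam) = k at *
  generalize √De = s at *
  subst hs2
  have e1 : t ^ 2 + s ^ 2 * k ^ 2 - s ^ 2 * (1 - T ^ 2) = t ^ 2 := by
    rw [hTk]; ring
  rw [e1, Real.sqrt_sq ht, Real.sin_arccos]
  set r := t ^ 2 + s ^ 2 * k ^ 2 with hr
  have hr0 : 0 < r := by positivity
  set w := k * (s * T + t) with hw
  have hw0 : 0 < w := by positivity
  have ha : T / k * w - s = s * (T ^ 2 - 1) + T * t := by rw [hw]; field_simp; ring
  have haw : (s * (T ^ 2 - 1) + T * t) ^ 2 + w ^ 2 = r := by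
    rw [hw, hr, hTk]
    linear_combination (t ^ 2 + k ^ 2 * s ^ 2) * hTk
  have e2 : 1 - ((s * (T ^ 2 - 1) + T * t) / √r) ^ 2 = w ^ 2 / r := by
    rw [div_pow, Real.sq_sqrt hr0.le]
    field_simp
    linarith
  rw [e2, Real.log_sqrt (by positivity), Real.log_div (by positivity) hr0.ne', ha, haw,
    Real.log_div hr0.ne' (by positivity), Real.log_div (by positivity) (by positivity)]
  ring

theorem rate₁_image_eq (hσ : 0 < σ) (hlam : 0 < lam) (hDe : 0 < De) :
    rate₁ σ lam De '' range₁ lam De = boundaryRate σ (√De) (threshold lam) (exp (-lam)) ''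
      Ioc (exp (-lam) * √De * threshold lam) (exp (-lam) * √De / threshold lam) := by
  have hTk := threshold_sq hlam
  have hT := threshold_pos hlam
  have hk : 0 < exp (-lam) := exp_pos _
  have hs := Real.sqrt_pos.2 hDe
  have hs2 := Real.sq_sqrt hDe.le
  have key := fun t (ht : 0 ≤ t) => rate₁_eq_boundaryRate (t := t) hσ hlam hDe ht
  rw [range₁, exp_neg_two_mul, ← hTk]
  generalize threshold lam = T at *
  generalize exp (-lam) = k at *
  have hend : De * k ^ 2 / T ^ 2 = (√De * k ^ 2 / T) ^ 2 + De * k ^ 2 := by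
    rw [div_pow, mul_pow, hs2]
    field_simp
    rw [hTk]; ring
  have hend2 : k * √De / T = k * (√De * T + √De * k ^ 2 / T) := by
    field_simp
    rw [hTk]; ring
  have hb : 0 ≤ √De * k ^ 2 / T := by positivity
  rw [hend, hend2]
  ext y
  constructor
  · rintro ⟨r, ⟨h1, h2⟩, rfl⟩
    have hr : r = √(r - De * k ^ 2) ^ 2 + De * k ^ 2 := by
      rw [Real.sq_sqrt (by linarith)]; ring
    have ht : 0 < √(r - De * k ^ 2) := Real.sqrt_pos.2 (by linarith)
    rw [hr, key _ ht.le]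
    refine ⟨_, ⟨?_, ?_⟩, rfl⟩
    · have := mul_pos hk ht
      linarith
    · have h3 : √(r - De * k ^ 2) ≤ √De * k ^ 2 / T := Real.sqrt_le_iff.2 ⟨hb, by linarith⟩
      gcongr
  · rintro ⟨w, ⟨h1, h2⟩, rfl⟩
    have ht : 0 < w / k - √De * T := by
      rw [sub_pos, lt_div_iff₀ hk]; linarith
    refine ⟨(w / k - √De * T) ^ 2 + De * k ^ 2, ⟨?_, ?_⟩, ?_⟩
    · have := pow_pos ht 2
      linarith
    · have : w / k - √De * T ≤ √De * k ^ 2 / T := by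
        rw [sub_le_iff_le_add, div_le_iff₀ hk]; linarith
      gcongr
    · rw [key _ ht.le]
      congr 1
      field_simp
      ring

theorem isLeast_E₁_of_boundary (hσ : 0 < σ) (hlam : 0 < lam) (hDe : 0 < De) {w₀ : ℝ}
    (hw₀ : w₀ ∈ Ioc (exp (-lam) * √De * threshold lam) (exp (-lam) * √De / threshold lam))
    (hmin : ∀ w, 0 < w → w ≤ exp (-lam) * √De / threshold lam →
      boundaryRate σ (√De) (threshold lam) (exp (-lam)) w₀
        ≤ boundaryRate σ (√De) (threshold lam) (exp (-lam)) w) :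
    IsLeast (rate₁ σ lam De '' range₁ lam De) (E₁ σ lam De) ∧
      E₁ σ lam De = boundaryRate σ (√De) (threshold lam) (exp (-lam)) w₀ := by
  have h : IsLeast (rate₁ σ lam De '' range₁ lam De)
      (boundaryRate σ (√De) (threshold lam) (exp (-lam)) w₀) := by
    rw [rate₁_image_eq hσ hlam hDe]
    refine ⟨mem_image_of_mem _ hw₀, ?_⟩
    rintro _ ⟨w, ⟨h1, h2⟩, rfl⟩
    have hT := threshold_pos hlam
    have hs := Real.sqrt_pos.2 hDe
    have : 0 < exp (-lam) * √De * threshold lam := by positivity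
    exact hmin w (this.trans h1) h2
  have hE : E₁ σ lam De = _ := h.csInf_eq
  exact ⟨hE ▸ h, hE⟩

/-- When the end point of the range is at most `σ²`, the minimum is attained there. -/
theorem isLeast_E₁_of_le (hσ : 0 < σ) (hlam : 0 < lam) (hDe : 0 < De)
    (h : De * exp (-2 * lam) / (1 - exp (-2 * lam)) ≤ σ ^ 2) :
    IsLeast (rate₁ σ lam De '' range₁ lam De) (E₁ σ lam De) ∧ 0 ≤ E₁ σ lam De := by
  have hTk := threshold_sq hlam
  have hT := threshold_pos hlam
  have hk : 0 < exp (-lam) := exp_pos _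
  have hs := Real.sqrt_pos.2 hDe
  have hs2 := Real.sq_sqrt hDe.le
  rw [exp_neg_two_mul, ← hTk] at h
  have hlt : threshold lam < 1 := by nlinarith [pow_pos hk 2]
  have hw₀ : 0 < exp (-lam) * √De / threshold lam := by positivity
  have hres := isLeast_E₁_of_boundary hσ hlam hDe (w₀ := exp (-lam) * √De / threshold lam)
    ⟨by rw [lt_div_iff₀ hT, mul_assoc _ (threshold lam)]
        exact mul_lt_of_lt_one_right (by positivity) (by nlinarith), le_rfl⟩ (by
      intro w hw hle
      refine le_trans ?_ (boundaryRate_lower (w₀ := exp (-lam) * √De / threshold lam)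
        hσ hk hTk hw hw₀)
      -- At the right end point the derivative reduces to `w₀ / σ² - 1 / w₀`. It is nonpositive
      -- because `w₀²` is at most `σ²`, and convexity then places the minimum there.
      have h1 : (exp (-lam) * √De / threshold lam / exp (-lam) ^ 2 - √De * threshold lam / exp (-lam))
          = exp (-lam) * √De / threshold lam := by
        field_simp
        rw [hTk]; ring
      rw [h1]
      set w₀ := exp (-lam) * √De / threshold lam with hw₀'
      have h2 : w₀ ^ 2 ≤ σ ^ 2 := by
        rw [hw₀', div_pow, mul_pow, hs2, mul_comm (exp (-lam) ^ 2)]; exact h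
      have h3 : w₀ / σ ^ 2 - 1 / w₀ ≤ 0 := by
        rw [sub_nonpos, div_le_div_iff₀ (by positivity) hw₀]; linarith
      have h4 := mul_nonneg_of_nonpos_of_nonpos (sub_nonpos.2 hle) h3
      have h5 : 0 ≤ (w - w₀) ^ 2 / (2 * exp (-lam) ^ 2 * σ ^ 2) := by positivity
      linarith)
  refine ⟨hres.1, ?_⟩
  rw [hres.2]
  exact gaussRate_nonneg (by positivity) (by positivity) _

/-- When the end point of the range exceeds `σ²`, the minimum is attained at an interior
stationary point. -/
theorem exists_boundaryRate_min (hσ : 0 < σ) (hlam : 0 < lam) (hDe : 0 < De)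
    (h : σ ^ 2 < De * exp (-2 * lam) / (1 - exp (-2 * lam))) :
    ∃ w ∈ Ioo (exp (-lam) * √De * threshold lam) (exp (-lam) * √De / threshold lam),
      w ^ 2 - √De * threshold lam * exp (-lam) * w - σ ^ 2 * exp (-lam) ^ 2 = 0 ∧
      ∀ y, 0 < y → boundaryRate σ (√De) (threshold lam) (exp (-lam)) w
          + (y - w) ^ 2 / (2 * exp (-lam) ^ 2 * σ ^ 2)
        ≤ boundaryRate σ (√De) (threshold lam) (exp (-lam)) y := by
  have hTk := threshold_sq hlam
  have hT := threshold_pos hlam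
  have hk : 0 < exp (-lam) := exp_pos _
  have hs := Real.sqrt_pos.2 hDe
  have hs2 := Real.sq_sqrt hDe.le
  rw [exp_neg_two_mul, ← hTk] at h
  generalize threshold lam = T at *
  generalize exp (-lam) = k at *
  generalize √De = s at *
  subst hs2
  have hlt : T < 1 := by nlinarith [pow_pos hk 2]
  have hle : k * s * T ≤ k * s / T := by
    rw [le_div_iff₀ hT, mul_assoc _ T]
    exact mul_le_of_le_one_right (by positivity) (by nlinarith)
  have hcont : ContinuousOn (fun w : ℝ => w ^ 2 - s * T * k * w - σ ^ 2 * k ^ 2)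
      (Icc (k * s * T) (k * s / T)) := by fun_prop
  -- The stationarity quadratic equals `-σ²k²` at the left end and `k²(s²k²/T² - σ²)` at the right
  -- end, so it changes sign.
  have h0 : (0 : ℝ) ∈ Ioo ((k * s * T) ^ 2 - s * T * k * (k * s * T) - σ ^ 2 * k ^ 2)
      ((k * s / T) ^ 2 - s * T * k * (k * s / T) - σ ^ 2 * k ^ 2) := by
    constructor
    · have : 0 < σ ^ 2 * k ^ 2 := by positivity
      linarith
    · have e : (k * s / T) ^ 2 - s * T * k * (k * s / T) - σ ^ 2 * k ^ 2
          = k ^ 2 * (s ^ 2 * k ^ 2 / T ^ 2 - σ ^ 2) := by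
        field_simp
        rw [hTk]; ring
      rw [e]
      exact mul_pos (by positivity) (by linarith)
  obtain ⟨w, hw, hroot⟩ := intermediate_value_Ioo hle hcont h0
  have hw0 : 0 < w := lt_trans (by positivity) hw.1
  refine ⟨w, hw, hroot, fun y hy => ?_⟩
  have hl := boundaryRate_lower (s := s) (w := y) (w₀ := w) hσ hk hTk hy hw0
  have hz : (w / k ^ 2 - s * T / k) / σ ^ 2 - 1 / w = 0 := by
    field_simp
    simp only at hroot
    linarith
  rw [hz] at hl
  linarith

end Range

/-! ### Exponents of the two embedders -/

theorem tendsto_gaussRate_variance {v₀ v : ℝ} (hv₀ : 0 < v₀) (hv : 0 < v) (a : ℝ) :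
    Tendsto (fun y => gaussRate v₀ a y) (𝓝 v) (𝓝 (gaussRate v₀ a v)) := by
  have h : ContinuousAt (fun y => Real.log (y / v₀)) v :=
    (continuousAt_id.div_const v₀).log (div_pos hv hv₀).ne'
  have h2 : ContinuousAt (fun y => (a ^ 2 + y) / v₀) v := by fun_prop
  exact ((h2.sub h).sub continuousAt_const).const_mul (1 / 2)

theorem tendsto_gaussRate_mean (v₀ v a : ℝ) :
    Tendsto (fun y => gaussRate v₀ y v) (𝓝 a) (𝓝 (gaussRate v₀ a v)) := by
  have h : Continuous fun y => gaussRate v₀ y v := by unfold gaussRate; fun_prop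
  exact h.tendsto a

/-- The optimal point lies on the boundary of the miss region, where the open-set bound need not
apply. It is approached along tilts to which that bound does apply. -/
theorem eventually_exp_le_of_tendsto {p : ℕ → ℝ} {I : ℝ → ℝ} {E : ℝ} {l : Filter ℝ} [l.NeBot]
    (hI : Tendsto I l (𝓝 E))
    (hp : ∀ᶠ t in l, ∀ ε > 0, ∀ᶠ n : ℕ in atTop, exp (-(n * (I t + ε))) ≤ p n) :
    ∀ ε > 0, ∀ᶠ n : ℕ in atTop, exp (-(n * (E + ε))) ≤ p n := by
  intro ε hε
  obtain ⟨t, h1, h2⟩ :=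
    ((hI.eventually_le_const (by linarith : E < E + ε / 2)).and hp).exists
  filter_upwards [h2 (ε / 2) (by positivity)] with n hn
  refine le_trans (Real.exp_le_exp.2 ?_) hn
  have := mul_le_mul_of_nonneg_left (by linarith : I t + ε / 2 ≤ E + ε) (Nat.cast_nonneg (α := ℝ) n)
  linarith

section Exponents

variable {σ lam De : ℝ} (u : ∀ n : ℕ, Fin n → ℝ)

theorem eventually_exp_le_additiveFN (hu : ∀ (n : ℕ) (i : Fin n), u n i = 1 ∨ u n i = -1)
    (hσ : 0 < σ) (hlam : 0 < lam) {a v : ℝ} (hv : 0 < v)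
    (h : exp (-lam) ^ 2 * (a + √De) ^ 2 < threshold lam ^ 2 * v ∨ a + √De ≤ 0) :
    ∀ ε > 0, ∀ᶠ n : ℕ in atTop,
      exp (-(n * (gaussRate (σ ^ 2) a v + ε))) ≤ additiveFN σ lam De (u n) := by
  intro ε hε
  have hT := threshold_pos hlam
  refine eventually_exp_le_of_isOpen u hu hσ hv
    (U := {q | q.1 + √De < threshold lam * √((q.1 + √De) ^ 2 + (q.2 - q.1 ^ 2))})
    (isOpen_lt (by fun_prop) (by fun_prop)) ?_ _
    (fun n hn x hx => normCorr_additive_le hn (hu n) hT.le (le_of_lt hx)) hε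
  change a + √De < threshold lam * √((a + √De) ^ 2 + (a ^ 2 + v - a ^ 2))
  have hN : 0 < (a + √De) ^ 2 + (a ^ 2 + v - a ^ 2) := by
    have := sq_nonneg (a + √De)
    linarith
  have hpos : 0 < threshold lam * √((a + √De) ^ 2 + (a ^ 2 + v - a ^ 2)) :=
    mul_pos hT (Real.sqrt_pos.2 hN)
  rcases h with h | h
  · refine lt_of_pow_lt_pow_left₀ 2 hpos.le ?_
    rw [mul_pow, Real.sq_sqrt hN.le]
    have := threshold_sq hlam
    have e : exp (-lam) ^ 2 = 1 - threshold lam ^ 2 := by linarith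
    rw [e] at h
    linarith
  · linarith

/-- The maximum with `σ²` merges both branches, as the zero-mean rate vanishes at variance `σ²`. -/
theorem E₂_eq_gaussRate (hσ : 0 < σ) :
    E₂ σ lam De = gaussRate (σ ^ 2) 0
      (max (De * exp (-2 * lam) / (1 - exp (-2 * lam))) (σ ^ 2)) := by
  have hσ2 : 0 < σ ^ 2 := by positivity
  rw [E₂, gaussRate]
  split_ifs with h
  · rw [max_eq_right h, div_self hσ2.ne', Real.log_one, zero_pow two_ne_zero, zero_add,
      div_self hσ2.ne']
    norm_num
  · rw [max_eq_left (not_le.1 h).le, zero_pow two_ne_zero, zero_add, div_div]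

theorem hasExponent_signFN (hu : ∀ (n : ℕ) (i : Fin n), u n i = 1 ∨ u n i = -1)
    (hσ : 0 < σ) (hlam : 0 < lam) (hDe : 0 < De) :
    HasExponent (fun n => signFN σ lam De (u n)) (E₂ σ lam De) := by
  have hσ2 : 0 < σ ^ 2 := by positivity
  have he : exp (-2 * lam) < 1 := Real.exp_lt_one_iff.2 (by linarith)
  have he0 := exp_pos (-2 * lam)
  have hs := Real.sqrt_pos.2 hDe
  have hs2 := Real.sq_sqrt hDe.le
  set z := De * exp (-2 * lam) / (1 - exp (-2 * lam)) with hz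
  have hz1 : z * (1 - exp (-2 * lam)) = De * exp (-2 * lam) :=
    div_mul_cancel₀ _ (by linarith)
  have hz0 : 0 < z := div_pos (by positivity) (by linarith)
  refine HasExponent.of_bounds ?_ ?_
  · rw [E₂_eq_gaussRate hσ, ← hz]
    -- A variance strictly above `z` puts `(0, v)` strictly inside the miss region.
    refine eventually_exp_le_of_tendsto (l := 𝓝[>] (max z (σ ^ 2)))
      ((tendsto_gaussRate_variance hσ2 (lt_max_of_lt_right hσ2) 0).mono_left nhdsWithin_le_nhds) ?_
    filter_upwards [self_mem_nhdsWithin] with v hv ε hε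
    have hzv : z < v := (le_max_left _ _).trans_lt hv
    refine eventually_exp_le_of_isOpen u hu hσ (hz0.trans hzv)
      (U := {q | (1 - (1 - exp (-2 * lam))) * (|q.1| + √De) ^ 2
        < (1 - exp (-2 * lam)) * (q.2 - q.1 ^ 2)})
      (isOpen_lt (by fun_prop) (by fun_prop)) ?_ _
      (fun n hn x hx => (normCorr_sign_sq_le_iff hn (hu n) hDe).2 (le_of_lt hx)) hε
    change (1 - (1 - exp (-2 * lam))) * (|0| + √De) ^ 2
        < (1 - exp (-2 * lam)) * (0 ^ 2 + v - 0 ^ 2)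
    rw [abs_zero, zero_add, hs2]
    nlinarith
  · filter_upwards [eventually_ne_atTop 0] with n hn
    rcases le_or_gt z (σ ^ 2) with h | h
    · rw [E₂, if_pos h, mul_zero, neg_zero, Real.exp_zero]
      exact measureReal_le_one.trans (by norm_num)
    · refine le_trans (covertextLaw_real_le hn (hu n) hσ hz0 0 _ _ fun x hx => ?_)
        (le_mul_of_one_le_left (exp_pos _).le one_le_two)
      have hx' := (normCorr_sign_sq_le_iff hn (hu n) hDe).1 hx
      rw [E₂_eq_gaussRate hσ, ← hz, max_eq_left h.le, logRatio]
      generalize innerProd (u n) x / n = A at *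
      generalize innerProd x x / n = R at *
      have hA : De ≤ (|A| + √De) ^ 2 := by nlinarith [abs_nonneg A]
      have hR : z ≤ R := by
        have h1 : 0 < 1 - exp (-2 * lam) := by linarith
        have h2 := mul_le_mul_of_nonneg_left hA he0.le
        have h3 := mul_nonneg h1.le (sq_nonneg A)
        refine le_of_mul_le_mul_right ?_ h1
        linarith
      have h4 : 1 / (2 * z) - 1 / (2 * σ ^ 2) ≤ 0 :=
        sub_nonpos.2 (one_div_le_one_div_of_le (by positivity) (by linarith))
      have h5 := mul_nonpos_of_nonneg_of_nonpos (sub_nonneg.2 hR) h4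
      simp only [zero_mul, zero_div, sub_zero, ne_eq, OfNat.ofNat_ne_zero, not_false_eq_true,
        zero_pow, zero_add]
      linarith

theorem hasExponent_additiveFN_of_le (hu : ∀ (n : ℕ) (i : Fin n), u n i = 1 ∨ u n i = -1)
    (hσ : 0 < σ) (hlam : 0 < lam) (hDe : 0 < De)
    (h : De * exp (-2 * lam) / (1 - exp (-2 * lam)) ≤ σ ^ 2) :
    HasExponent (fun n => additiveFN σ lam De (u n)) 0 := by
  have hσ2 : 0 < σ ^ 2 := by positivity
  have hT := threshold_pos hlam
  have hTk := threshold_sq hlam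
  have hs2 := Real.sq_sqrt hDe.le
  have hE : gaussRate (σ ^ 2) 0 (σ ^ 2) = 0 := by
    have h1 := E₂_eq_gaussRate (lam := lam) (De := De) hσ
    rw [max_eq_right h, E₂, if_pos h] at h1
    exact h1.symm
  refine HasExponent.of_bounds ?_ (.of_forall fun n => ?_)
  · refine eventually_exp_le_of_tendsto (l := 𝓝[>] (σ ^ 2))
      ((hE ▸ tendsto_gaussRate_variance hσ2 hσ2 0).mono_left nhdsWithin_le_nhds) ?_
    filter_upwards [self_mem_nhdsWithin] with v hv
    refine eventually_exp_le_additiveFN u hu hσ hlam (hσ2.trans hv) (.inl ?_)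
    have hlt := h.trans_lt hv
    rw [exp_neg_two_mul, ← hTk, div_lt_iff₀ (by positivity)] at hlt
    rw [zero_add, hs2]
    linarith
  · rw [mul_zero, neg_zero, Real.exp_zero]
    exact measureReal_le_one.trans (by norm_num)

/-- The quadratic miss region lies in the half-plane tangent to it at the stationary point. -/
theorem logRatio_le_of_stationary {s T k w A R : ℝ} (hσ : 0 < σ) (hT : 0 < T) (hk : 0 < k)
    (hTk : T ^ 2 = 1 - k ^ 2) (hw : 0 < w) (hσw : σ ^ 2 ≤ w ^ 2)
    (hroot : w ^ 2 - s * T * k * w - σ ^ 2 * k ^ 2 = 0)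
    (h : k ^ 2 * (A + s) ^ 2 ≤ T ^ 2 * (R - A ^ 2)) :
    logRatio (σ ^ 2) (T / k * w - s) (w ^ 2) A R ≤ -boundaryRate σ s T k w := by
  rw [logRatio, boundaryRate]
  set p := 1 / (2 * σ ^ 2) - 1 / (2 * w ^ 2) with hp
  have hp0 : 0 ≤ p := sub_nonneg.2 (one_div_le_one_div_of_le (by positivity) (by linarith))
  have hR : 0 ≤ R - A ^ 2 - k ^ 2 / T ^ 2 * (A + s) ^ 2 := by
    rw [sub_nonneg, div_mul_eq_mul_div, div_le_iff₀ (by positivity)]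
    linarith
  set a := T / k * w - s with ha
  -- Stationarity: the derivative of `p * R + a * A / w²` along the boundary parabola vanishes at `A
  -- = a`. The linear term in `A - a` therefore drops out of `key`, leaving nonnegative terms
  -- because `p ≥ 0`.
  have hslope : 2 * p * (w / (T * k) - s) + a / w ^ 2 = 0 := by
    have h1 : w / (T * k) - s = σ ^ 2 * k / (T * w) := by
      field_simp
      linarith
    rw [h1, hp, ha]
    field_simp
    linear_combination hroot + w ^ 2 * hTk
  have hquad : A ^ 2 + k ^ 2 / T ^ 2 * (A + s) ^ 2 - a ^ 2 - w ^ 2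
      = (A - a) ^ 2 / T ^ 2 + 2 * (A - a) * (w / (T * k) - s) := by
    have hAs : A + s = (A - a) + T / k * w := by rw [ha]; ring
    have h1 : k ^ 2 / T ^ 2 = 1 / T ^ 2 - 1 := by field_simp; linarith
    have h2 : w / (T * k) - s = a + k / T * w := by
      rw [ha]; field_simp; linear_combination (-w) * hTk
    have h3 : k ^ 2 / T ^ 2 * ((A - a) + T / k * w) ^ 2
        = k ^ 2 / T ^ 2 * (A - a) ^ 2 + 2 * (k / T) * w * (A - a) + w ^ 2 := by
      field_simp
      ring
    rw [hAs, h3, h1, h2]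
    ring
  have key : (R - (a ^ 2 + w ^ 2)) * p + a * (A - a) / w ^ 2
      = p * (R - A ^ 2 - k ^ 2 / T ^ 2 * (A + s) ^ 2) + p * ((A - a) ^ 2 / T ^ 2) := by
    linear_combination p * hquad + (A - a) * hslope
  have h4 := mul_nonneg hp0 hR
  have h5 : 0 ≤ p * ((A - a) ^ 2 / T ^ 2) := by positivity
  have h6 : 1 / (2 * w ^ 2) - 1 / (2 * σ ^ 2) = -p := by rw [hp]; ring
  rw [h6]
  linarith

theorem hasExponent_additiveFN_of_lt (hu : ∀ (n : ℕ) (i : Fin n), u n i = 1 ∨ u n i = -1)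
    (hσ : 0 < σ) (hlam : 0 < lam) (hDe : 0 < De)
    (h : σ ^ 2 < De * exp (-2 * lam) / (1 - exp (-2 * lam))) :
    IsLeast (rate₁ σ lam De '' range₁ lam De) (E₁ σ lam De) ∧ E₁ σ lam De < E₂ σ lam De ∧
      HasExponent (fun n => additiveFN σ lam De (u n)) (E₁ σ lam De) := by
  have hσ2 : 0 < σ ^ 2 := by positivity
  have hT := threshold_pos hlam
  have hk : 0 < exp (-lam) := exp_pos _
  have hTk := threshold_sq hlam
  have hs := Real.sqrt_pos.2 hDe
  have hs2 := Real.sq_sqrt hDe.le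
  obtain ⟨w, hw, hroot, hmin⟩ := exists_boundaryRate_min hσ hlam hDe h
  obtain ⟨hleast, hE⟩ := isLeast_E₁_of_boundary hσ hlam hDe (Ioo_subset_Ioc_self hw)
    (fun y hy _ => le_trans (le_add_of_nonneg_right (by positivity)) (hmin y hy))
  have hw0 : 0 < w := lt_trans (by positivity) hw.1
  have hz : (exp (-lam) * √De / threshold lam) ^ 2
      = De * exp (-2 * lam) / (1 - exp (-2 * lam)) := by
    rw [exp_neg_two_mul, ← hTk, div_pow, mul_pow, hs2, mul_comm]
  have hwT : threshold lam * w < exp (-lam) * √De := by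
    have := hw.2
    rw [lt_div_iff₀ hT] at this
    linarith
  -- Combining the root equation with `T w < k s` gives `k² w² > k² σ²`.
  have hσw : σ ^ 2 ≤ w ^ 2 := by
    have h1 := mul_lt_mul_of_pos_left hwT (mul_pos hT hw0)
    refine le_of_mul_le_mul_left ?_ (pow_pos hk 2)
    have e : exp (-lam) ^ 2 = 1 - threshold lam ^ 2 := by linarith
    nlinarith
  refine ⟨hleast, ?_, HasExponent.of_bounds ?_ ?_⟩
  · have hy := hmin (exp (-lam) * √De / threshold lam) (by positivity)
    have hend : boundaryRate σ (√De) (threshold lam) (exp (-lam))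
        (exp (-lam) * √De / threshold lam) = E₂ σ lam De := by
      rw [boundaryRate, E₂_eq_gaussRate hσ, max_eq_left h.le, hz]
      congr 1
      field_simp
      ring
    have hpos : 0 < (exp (-lam) * √De / threshold lam - w) ^ 2 / (2 * exp (-lam) ^ 2 * σ ^ 2) :=
      div_pos (pow_pos (sub_pos.2 hw.2) 2) (by positivity)
    rw [hend] at hy
    linarith
  · rw [hE]
    -- Lowering the mean at fixed variance `w²` moves the boundary point into the interior of the
    -- miss region.
    refine eventually_exp_le_of_tendsto (l := 𝓝[<] (threshold lam / exp (-lam) * w - √De))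
      ((tendsto_gaussRate_mean (σ ^ 2) (w ^ 2) _).mono_left nhdsWithin_le_nhds) ?_
    filter_upwards [self_mem_nhdsWithin] with a ha
    refine eventually_exp_le_additiveFN u hu hσ hlam (pow_pos hw0 2) ?_
    rcases le_or_gt (a + √De) 0 with h0 | h0
    · exact .inr h0
    · left
      rw [← mul_pow, ← mul_pow]
      refine pow_lt_pow_left₀ ?_ (by positivity) two_ne_zero
      have h1 : a + √De < threshold lam / exp (-lam) * w := lt_sub_iff_add_lt.1 ha
      rw [div_mul_eq_mul_div, lt_div_iff₀ hk] at h1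
      linarith
  -- The half-plane `A ≤ -√De` has rate `De / (2σ²)`. Comparing with the boundary point `w = σ`,
  -- whose mean lies between `-√De` and 0, shows that this rate is no smaller than `E₁`.
  · have hEσ : E₁ σ lam De ≤ gaussRate (σ ^ 2) (-√De) (σ ^ 2) := by
      rw [hE]
      refine le_trans (le_trans (le_add_of_nonneg_right (by positivity)) (hmin σ hσ)) ?_
      have h1 : threshold lam / exp (-lam) * σ ≤ √De := by
        rw [← hz] at h
        have h2 := lt_of_pow_lt_pow_left₀ 2 (by positivity) h
        rw [lt_div_iff₀ hT] at h2
        rw [div_mul_eq_mul_div, div_le_iff₀ hk]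
        linarith
      have h2 : 0 ≤ threshold lam / exp (-lam) * σ := by positivity
      rw [boundaryRate, gaussRate, gaussRate]
      gcongr 1 / 2 * ((?_ + _) / _ - _ - _)
      nlinarith
    filter_upwards [eventually_ne_atTop 0] with n hn
    -- With tilted variance `σ²` the coefficient of `R` vanishes, so the bound on `A` suffices.
    have hF1 := covertextLaw_real_le hn (hu n) hσ hσ2 (-√De) (E₁ σ lam De)
      {x | innerProd (u n) x / n ≤ -√De} (fun x hx => by
        rw [logRatio, sub_self, mul_zero, add_zero]
        have : 0 ≤ -√De * (innerProd (u n) x / n - -√De) / σ ^ 2 :=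
          div_nonneg (mul_nonneg_of_nonpos_of_nonpos (by linarith) (sub_nonpos.2 hx)) hσ2.le
        linarith)
    have hF2 := covertextLaw_real_le hn (hu n) hσ (pow_pos hw0 2)
      (threshold lam / exp (-lam) * w - √De) (E₁ σ lam De)
      {x | (1 - threshold lam ^ 2) * (innerProd (u n) x / n + √De) ^ 2
        ≤ threshold lam ^ 2 * (innerProd x x / n - (innerProd (u n) x / n) ^ 2)} (fun x hx => by
        rw [hE]
        refine logRatio_le_of_stationary hσ hT hk hTk hw0 hσw hroot ?_
        have e : exp (-lam) ^ 2 = 1 - threshold lam ^ 2 := by linarith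
        rw [e]
        exact hx)
    calc additiveFN σ lam De (u n) ≤ _ :=
          measureReal_mono fun x hx => moments_of_normCorr_additive_le hn (hu n) hx
      _ ≤ _ := measureReal_union_le _ _
      _ ≤ _ := add_le_add hF1 hF2
      _ = 2 * exp (-(n * E₁ σ lam De)) := (two_mul _).symm

end Exponents

end Watermark

theorem theorem4 (σ lam De : ℝ) (hσ : 0 < σ) (hlam : 0 < lam) (hDe : 0 < De)
    (u : ∀ n : ℕ, Fin n → ℝ) (hu : ∀ (n : ℕ) (i : Fin n), u n i = 1 ∨ u n i = -1) :
    -- the infimum defining `E₁` is a minimum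
    IsLeast (Watermark.rate₁ σ lam De '' Watermark.range₁ lam De) (Watermark.E₁ σ lam De) ∧
    -- both false-negative exponents exist and have the stated values
    ∃ Eae Ese : ℝ,
      Watermark.HasExponent (fun n => Watermark.additiveFN σ lam De (u n)) Eae ∧
      Watermark.HasExponent (fun n => Watermark.signFN σ lam De (u n)) Ese ∧
      Eae = min (Watermark.E₁ σ lam De) (Watermark.E₂ σ lam De) ∧
      Ese = Watermark.E₂ σ lam De ∧
      (σ ^ 2 < De * Real.exp (-2 * lam) / (1 - Real.exp (-2 * lam)) → Eae < Ese) := by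
  have hsign := Watermark.hasExponent_signFN u hu hσ hlam hDe
  rcases le_or_gt (De * Real.exp (-2 * lam) / (1 - Real.exp (-2 * lam))) (σ ^ 2) with h | h
  · obtain ⟨hleast, h0⟩ := Watermark.isLeast_E₁_of_le hσ hlam hDe h
    have hE₂ : Watermark.E₂ σ lam De = 0 := if_pos h
    refine ⟨hleast, 0, _, Watermark.hasExponent_additiveFN_of_le u hu hσ hlam hDe h, hsign, ?_,
      rfl, fun h' => absurd h (not_le.2 h')⟩
    rw [hE₂, min_eq_right h0]
  · obtain ⟨hleast, hlt, hadd⟩ := Watermark.hasExponent_additiveFN_of_lt u hu hσ hlam hDe h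
    exact ⟨hleast, _, _, hadd, hsign, (min_eq_left hlt.le).symm, rfl, fun _ => hlt⟩
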